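/- Let $W\subset\mathbb R^4$ be an open set of points $(t,x,u,u_x)$ whose projection $\Omega\subset\mathbb R^3$ to $(t,x,u)$-space is connected and nonempty, and let $F=F(t,x,u,u_x)$ be a real-valued $C^\infty$ function on $W$ with $F_{u_xu_x}\not\equiv 0$ on $W$ (i.e. $F_{u_xu_x}\ne 0$ at some point of $W$). Consider the equation $$u_{tt}=u_{xx}+F(t,x,u,u_x).$$ An operator $Q=\tau(t,x,u)\partial_t+\xi(t,x,u)\partial_x+\eta(t,x,u)\partial_u$ with coefficients in $C^\infty(\Omega)$ is an (infinitesimal) symmetry of the equation if it satisfies Lie's invariance criterion $$\varphi^{tt}-\varphi^{xx}-\tau F_t-\xi F_x-\eta F_u-\varphi^xF_{u_x}=0\quad\text{whenever } u_{tt}=u_{xx}+F \text{ and } (t,x,u,u_x)\in W,$$ where, with $D_t,D_x$ the total derivatives, $\varphi^t=D_t\eta-u_tD_t\tau-u_xD_t\xi$, $\varphi^x=D_x\eta-u_tD_x\tau-u_xD_x\xi$, $\varphi^{tt}=D_t\varphi^t-u_{tt}D_t\tau-u_{tx}D_t\xi$, $\varphi^{xx}=D_x\varphi^x-u_{tx}D_x\tau-u_{xx}D_x\xi$,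 and $u_t,u_{tx},u_{xx}$ range over all of $\mathbb R$. The equation admits a real Lie algebra $\mathfrak g$ of smooth vector fields on $\Omega$ (with the commutator as bracket) if every element of $\mathfrak g$ is a symmetry. Theorem. If the equation admits the Lie algebra $\mathfrak g$ (possibly infinite-dimensional), then no finite-dimensional subalgebra of $\mathfrak g$ has a nontrivial Levi factor, a Levi factor being a semisimple subalgebra that is a vector-space complement of the solvable radical. Moreover, if $\mathfrak g$ is finite-dimensional, then $\mathfrak g$ is solvable. -/

import Mathlib

open scoped ContDiff

noncomputable section

namespace WaveSymmetry

open VectorField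

/-- The space of points `(t, x, u)`. -/
abbrev Base : Type := ℝ × ℝ × ℝ

/-! ### The Lie algebra of smooth vector fields on an open set of `(t, x, u)`-space -/

/-- Smooth vector fields on `Ω`, as functions on `Base` that are normalised to be zero outside `Ω`
(so that two fields are equal iff they agree on `Ω`). -/
def smoothFieldSubmodule (Ω : TopologicalSpace.Opens Base) : Submodule ℝ (Base → Base) where
  carrier := {V | ContDiffOn ℝ ∞ V Ω ∧ ∀ z, z ∉ Ω → V z = 0}
  add_mem' := fun {V W} hV hW =>
    ⟨hV.1.add hW.1, fun z hz => by simp [hV.2 z hz, hW.2 z hz]⟩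
  zero_mem' := ⟨contDiffOn_const, fun _ _ => rfl⟩
  smul_mem' := fun c V hV =>
    ⟨contDiffOn_const.smul hV.1, fun z hz => by simp [hV.2 z hz]⟩

/-- First-order operators `Q = τ ∂_t + ξ ∂_x + η ∂_u` with coefficients smooth on `Ω`. -/
def SmoothField (Ω : TopologicalSpace.Opens Base) : Type := smoothFieldSubmodule Ω

namespace SmoothField

variable {Ω : TopologicalSpace.Opens Base}

instance : AddCommGroup (SmoothField Ω) := inferInstanceAs (AddCommGroup (smoothFieldSubmodule Ω))

instance : Module ℝ (SmoothField Ω) := inferInstanceAs (Module ℝ (smoothFieldSubmodule Ω))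

/-- The coefficient function `(τ, ξ, η)` of a field. -/
def coeff (V : SmoothField Ω) : Base → Base := V.1

theorem ext_on {V W : SmoothField Ω} (h : ∀ z ∈ Ω, V.coeff z = W.coeff z) : V = W := by
  apply Subtype.ext
  funext z
  by_cases hz : z ∈ Ω
  · exact h z hz
  · exact (V.2.2 z hz).trans (W.2.2 z hz).symm

theorem coeff_add (V W : SmoothField Ω) : (V + W).coeff = V.coeff + W.coeff := rfl

theorem coeff_smul (c : ℝ) (V : SmoothField Ω) : (c • V).coeff = c • V.coeff := rfl

theorem coeff_zero : (0 : SmoothField Ω).coeff = 0 := rfl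

theorem contDiffAt (V : SmoothField Ω) {z : Base} (hz : z ∈ Ω) : ContDiffAt ℝ ∞ V.coeff z :=
  V.2.1.contDiffAt (Ω.isOpen.mem_nhds hz)

theorem differentiableAt (V : SmoothField Ω) {z : Base} (hz : z ∈ Ω) :
    DifferentiableAt ℝ V.coeff z :=
  (V.contDiffAt hz).differentiableAt (by simp)

/-- The commutator of two operators: on `Ω` its coefficients are those of
`V ∘ W - W ∘ V`, that is `D W (V) - D V (W)`. -/
instance : Bracket (SmoothField Ω) (SmoothField Ω) where
  bracket V W :=
    ⟨(Ω : Set Base).indicator (lieBracket ℝ V.coeff W.coeff), by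
      constructor
      · have h : ContDiffOn ℝ ∞ (lieBracket ℝ V.coeff W.coeff) Ω := fun z hz =>
          ((V.contDiffAt hz).lieBracket_vectorField (m := ∞) (W.contDiffAt hz)
            (by simp)).contDiffWithinAt
        exact h.congr fun z hz => Set.indicator_of_mem hz _
      · intro z hz
        exact Set.indicator_of_notMem hz _⟩

theorem coeff_bracket (V W : SmoothField Ω) {z : Base} (hz : z ∈ Ω) :
    ⁅V, W⁆.coeff z = lieBracket ℝ V.coeff W.coeff z :=
  Set.indicator_of_mem (s := (Ω : Set Base)) hz _

theorem coeff_bracket_eventuallyEq (V W : SmoothField Ω) {z : Base} (hz : z ∈ Ω) :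
    ⁅V, W⁆.coeff =ᶠ[nhds z] lieBracket ℝ V.coeff W.coeff := by
  filter_upwards [Ω.isOpen.mem_nhds hz] with y hy
  exact coeff_bracket V W hy

instance : LieRing (SmoothField Ω) where
  add_lie U V W := ext_on fun z hz => by
    rw [coeff_add, Pi.add_apply, coeff_bracket _ _ hz, coeff_bracket _ _ hz, coeff_bracket _ _ hz,
      coeff_add, lieBracket_add_left (U.differentiableAt hz) (V.differentiableAt hz)]
  lie_add U V W := ext_on fun z hz => by
    rw [coeff_add, Pi.add_apply, coeff_bracket _ _ hz, coeff_bracket _ _ hz, coeff_bracket _ _ hz,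
      coeff_add, lieBracket_add_right (V.differentiableAt hz) (W.differentiableAt hz)]
  lie_self U := ext_on fun z hz => by
    rw [coeff_bracket _ _ hz, lieBracket_self, coeff_zero]
  leibniz_lie U V W := ext_on fun z hz => by
    rw [coeff_add, Pi.add_apply, coeff_bracket _ _ hz, coeff_bracket _ _ hz, coeff_bracket _ _ hz,
      Filter.EventuallyEq.lieBracket_vectorField_eq Filter.EventuallyEq.rfl
        (coeff_bracket_eventuallyEq V W hz),
      Filter.EventuallyEq.lieBracket_vectorField_eq (coeff_bracket_eventuallyEq U V hz)
        Filter.EventuallyEq.rfl,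
      Filter.EventuallyEq.lieBracket_vectorField_eq Filter.EventuallyEq.rfl
        (coeff_bracket_eventuallyEq U W hz)]
    exact leibniz_identity_lieBracket (n := ∞)
      (by simpa using WithTop.coe_le_coe.2 (le_top : (2 : ℕ∞) ≤ ⊤)) (U.contDiffAt hz) (V.contDiffAt hz)
      (W.contDiffAt hz)

instance : LieAlgebra ℝ (SmoothField Ω) where
  lie_smul c V W := ext_on fun z hz => by
    rw [coeff_smul, Pi.smul_apply, coeff_bracket _ _ hz, coeff_bracket _ _ hz, coeff_smul,
      lieBracket_const_smul_right (W.differentiableAt hz)]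

/-- The coefficient `τ` of `∂_t`. -/
def tau (Q : SmoothField Ω) (z : Base) : ℝ := (Q.coeff z).1

/-- The coefficient `ξ` of `∂_x`. -/
def xi (Q : SmoothField Ω) (z : Base) : ℝ := (Q.coeff z).2.1

/-- The coefficient `η` of `∂_u`. -/
def eta (Q : SmoothField Ω) (z : Base) : ℝ := (Q.coeff z).2.2

end SmoothField

/-! ### Jets, total derivatives and prolongation -/

/-- First jets `((t, x, u), u_t, u_x)`. -/
abbrev Jet1 : Type := Base × ℝ × ℝ

/-- Second jets `(((t, x, u), u_t, u_x), u_tt, u_tx, u_xx)`. -/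
abbrev Jet2 : Type := Jet1 × ℝ × ℝ × ℝ

namespace Jet1

/-- The point `(t, x, u)`. -/
def base (j : Jet1) : Base := j.1

/-- The coordinate `u_t`. -/
def ut (j : Jet1) : ℝ := j.2.1

/-- The coordinate `u_x`. -/
def ux (j : Jet1) : ℝ := j.2.2

end Jet1

namespace Jet2

/-- The underlying first jet. -/
def jet1 (j : Jet2) : Jet1 := j.1

/-- The coordinate `u_tt`. -/
def utt (j : Jet2) : ℝ := j.2.1

/-- The coordinate `u_tx`. -/
def utx (j : Jet2) : ℝ := j.2.2.1

/-- The coordinate `u_xx`. -/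
def uxx (j : Jet2) : ℝ := j.2.2.2

end Jet2

/-- Total `t`-derivative of a function of `(t, x, u)`: `D_t f = f_t + u_t f_u`. -/
def totalT (f : Base → ℝ) (j : Jet1) : ℝ := fderiv ℝ f j.base (1, 0, j.ut)

/-- Total `x`-derivative of a function of `(t, x, u)`: `D_x f = f_x + u_x f_u`. -/
def totalX (f : Base → ℝ) (j : Jet1) : ℝ := fderiv ℝ f j.base (0, 1, j.ux)

/-- Total `t`-derivative of a function on first jets:
`D_t φ = φ_t + u_t φ_u + u_tt φ_{u_t} + u_tx φ_{u_x}`. -/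
def totalT₁ (φ : Jet1 → ℝ) (j : Jet2) : ℝ :=
  fderiv ℝ φ j.jet1 ((1, 0, j.jet1.ut), j.utt, j.utx)

/-- Total `x`-derivative of a function on first jets:
`D_x φ = φ_x + u_x φ_u + u_tx φ_{u_t} + u_xx φ_{u_x}`. -/
def totalX₁ (φ : Jet1 → ℝ) (j : Jet2) : ℝ :=
  fderiv ℝ φ j.jet1 ((0, 1, j.jet1.ux), j.utx, j.uxx)

section Prolongation

variable {Ω : TopologicalSpace.Opens Base}

/-- `φ^t = D_t η - u_t D_t τ - u_x D_t ξ`. -/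
def phiT (Q : SmoothField Ω) (j : Jet1) : ℝ :=
  totalT Q.eta j - j.ut * totalT Q.tau j - j.ux * totalT Q.xi j

/-- `φ^x = D_x η - u_t D_x τ - u_x D_x ξ`. -/
def phiX (Q : SmoothField Ω) (j : Jet1) : ℝ :=
  totalX Q.eta j - j.ut * totalX Q.tau j - j.ux * totalX Q.xi j

/-- `φ^{tt} = D_t φ^t - u_tt D_t τ - u_tx D_t ξ`. -/
def phiTT (Q : SmoothField Ω) (j : Jet2) : ℝ :=
  totalT₁ (phiT Q) j - j.utt * totalT Q.tau j.jet1 - j.utx * totalT Q.xi j.jet1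

/-- `φ^{xx} = D_x φ^x - u_tx D_x τ - u_xx D_x ξ`. -/
def phiXX (Q : SmoothField Ω) (j : Jet2) : ℝ :=
  totalX₁ (phiX Q) j - j.utx * totalX Q.tau j.jet1 - j.uxx * totalX Q.xi j.jet1

end Prolongation

/-! ### Symmetries of `u_tt = u_xx + F(t, x, u, u_x)` -/

/-- The open set of points `(t, x, u)` over which `F(t, x, u, u_x)` is defined for some `u_x`, when
`W` is the domain of `F`. A point of `W` is a pair `((t, x, u), u_x)`. -/
def baseDomain (W : TopologicalSpace.Opens (Base × ℝ)) : TopologicalSpace.Opens Base :=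
  ⟨Prod.fst '' (W : Set (Base × ℝ)), isOpenMap_fst _ W.isOpen⟩

/-- Lie's infinitesimal invariance criterion: the second prolongation of `Q` annihilates
`u_tt - u_xx - F(t, x, u, u_x)` at all second jets over `W` that satisfy the equation. The last
term is `τ F_t + ξ F_x + η F_u + φ^x F_{u_x}`. -/
def IsSymmetry (W : TopologicalSpace.Opens (Base × ℝ)) (F : Base × ℝ → ℝ)
    (Q : SmoothField (baseDomain W)) : Prop :=
  ∀ j : Jet2, (j.jet1.base, j.jet1.ux) ∈ W →
    j.utt = j.uxx + F (j.jet1.base, j.jet1.ux) →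
    phiTT Q j - phiXX Q j
      - fderiv ℝ F (j.jet1.base, j.jet1.ux) (Q.coeff j.jet1.base, phiX Q j.jet1) = 0

/-- The equation `u_tt = u_xx + F(t, x, u, u_x)` admits the Lie algebra `g` of vector fields. -/
def Admits (W : TopologicalSpace.Opens (Base × ℝ)) (F : Base × ℝ → ℝ)
    (g : LieSubalgebra ℝ (SmoothField (baseDomain W))) : Prop :=
  ∀ Q ∈ g, IsSymmetry W F Q

/-- The second partial derivative `F_{u_x u_x}`. -/
def secondPartial (F : Base × ℝ → ℝ) (w : Base × ℝ) : ℝ :=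
  deriv (deriv fun p => F (w.1, p)) w.2

/-- A Levi factor of a Lie algebra: a semisimple subalgebra that is a vector space complement of
the solvable radical. -/
structure IsLeviFactor {s : Type*} [LieRing s] [LieAlgebra ℝ s] (l : LieSubalgebra ℝ s) :
    Prop where
  semisimple : LieAlgebra.IsSemisimple ℝ l
  isCompl : IsCompl l.toSubmodule (LieAlgebra.radical ℝ s).toSubmodule

end WaveSymmetry

end

noncomputable section

namespace WaveSymmetry

open VectorField

/-! The derived series of a finite-dimensional Lie algebra stabilises at a perfect ideal, so
solvability follows once every finite-dimensional perfect space `P` of symmetries is zero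
(`isSolvable_of_perfectSpace_eq_bot`).

Locally, `exists_open_fderiv_ne` gives an open set `U` over which `F_{u_x}` differs at two fixed
slopes. There the determining equations force τ = τ(t), ξ = ξ(x) and τ_t = ξ_x locally, whence τ and
ξ are affine, while η is affine in u. A bracket then acts on τ as a bracket of affine fields on a
line: its derivative is zero, so perfectness makes τ_t vanish for all of `P`, and then τ itself. The
same argument disposes of ξ and, once τ = ξ = 0, of η (`IsPerfectSpace.component_eq_zero`).

Globally, F may be affine in u_x elsewhere, and smooth fields need not be analytic, so zeros are
propagated by perfectness alone. At a limit point of the set where `P` vanishes locally, all first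
derivatives vanish; each generator is a combination of terms DW(V) − DV(W), so the total size `N` of
the generators satisfies N = o(N) and is zero nearby (`IsPerfectSpace.eventually_eq_zero`). The
vanishing set is thus open and relatively closed in the connected domain (`IsPerfectSpace.eq_bot`).
-/

theorem two_le_infty : (2 : WithTop ℕ∞) ≤ ∞ := by
  exact WithTop.coe_le_coe.2 (le_top : (2 : ℕ∞) ≤ ⊤)

/-! ### Propagation of zeros for perfect Lie algebras of vector fields -/

section Perfect

variable {Ω : TopologicalSpace.Opens Base}

/-- A space of fields is spanned by the brackets of its elements. -/
def IsPerfectSpace (P : Submodule ℝ (SmoothField Ω)) : Prop :=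
  P ≤ Submodule.span ℝ {Z | ∃ V ∈ P, ∃ W ∈ P, ⁅V, W⁆ = Z}

theorem SmoothField.continuousAt_fderiv (V : SmoothField Ω) {z : Base} (hz : z ∈ Ω) :
    ContinuousAt (fderiv ℝ V.coeff) z :=
  ((V.contDiffAt hz).fderiv_right (m := 0) (by simp)).continuousAt

open Asymptotics Filter Topology in
/-- A finite-dimensional perfect space of fields whose 1-jets at a point all vanish is zero
near that point. -/
theorem IsPerfectSpace.eventually_eq_zero {P : Submodule ℝ (SmoothField Ω)}
    (hP : IsPerfectSpace P) (hfin : P.FG) {z : Base} (hz : z ∈ Ω)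
    (h1 : ∀ V ∈ P, fderiv ℝ V.coeff z = 0) :
    ∀ V ∈ P, V.coeff =ᶠ[𝓝 z] 0 := by
  obtain ⟨S, hS⟩ := hfin
  set N : Base → ℝ := fun y => ∑ s ∈ S, ‖s.coeff y‖ with hN
  have hbig : ∀ V ∈ P, V.coeff =O[𝓝 z] N := by
    intro V hV
    rw [← hS] at hV
    induction hV using Submodule.span_induction with
    | mem V hV =>
      refine IsBigO.of_bound 1 (Eventually.of_forall fun y => ?_)
      rw [one_mul]
      refine le_trans ?_ (le_abs_self _)
      exact Finset.single_le_sum (f := fun s : SmoothField Ω => ‖s.coeff y‖)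
        (fun _ _ => norm_nonneg _) hV
    | zero => exact isBigO_zero _ _
    | add V W _ _ hV hW => exact hV.add hW
    | smul c V _ hV => exact hV.const_smul_left c
  have hd : ∀ V ∈ P, fderiv ℝ V.coeff =o[𝓝 z] (fun _ => (1 : ℝ)) := by
    intro V hV
    rw [isLittleO_one_iff, ← h1 V hV]
    exact V.continuousAt_fderiv hz
  -- The operator norm bound gives o(1) · O(N).
  have happ : ∀ V ∈ P, ∀ W ∈ P, (fun y => fderiv ℝ V.coeff y (W.coeff y)) =o[𝓝 z] N := by
    intro V hV W hW
    have h := (hd V hV).norm_left.mul_isBigO (hbig W hW).norm_left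
    simp only [one_mul] at h
    refine IsBigO.trans_isLittleO (IsBigO.of_bound 1 (Eventually.of_forall fun y => ?_)) h
    rw [one_mul, Real.norm_of_nonneg (by positivity)]
    exact ContinuousLinearMap.le_opNorm _ _
  -- Perfectness upgrades O(N) to o(N): both halves of a bracket are of the form just estimated.
  have hlit : ∀ V ∈ P, V.coeff =o[𝓝 z] N := by
    intro V hV
    replace hV := hP hV
    induction hV using Submodule.span_induction with
    | mem Z hZ =>
      obtain ⟨V, hV, W, hW, rfl⟩ := hZ
      refine IsLittleO.congr' ((happ W hW V hV).sub (happ V hV W hW)) ?_ EventuallyEq.rfl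
      exact (SmoothField.coeff_bracket_eventuallyEq V W hz).symm
    | zero => exact isLittleO_zero _ _
    | add V W _ _ hV hW => exact hV.add hW
    | smul c V _ hV => exact hV.const_smul_left c
  have hNN : N =o[𝓝 z] N := by
    have h : ∀ s ∈ S, (fun y => ‖s.coeff y‖) =o[𝓝 z] N := fun s hs =>
      (hlit s (hS ▸ Submodule.subset_span hs)).norm_left
    simpa only [hN, Finset.sum_fn] using IsLittleO.sum h
  have hN0 : ∀ᶠ y in 𝓝 z, N y = 0 := by
    filter_upwards [hNN.def (c := 1 / 2) (by norm_num)] with y hy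
    have := norm_nonneg (N y)
    exact norm_eq_zero.1 (by linarith)
  intro V hV
  filter_upwards [(hbig V hV).eq_zero_imp, hN0] with y hy hNy using hy hNy

open Filter Topology in
/-- A finite-dimensional perfect space of fields on a connected domain that vanishes near one
point is trivial. -/
theorem IsPerfectSpace.eq_bot {P : Submodule ℝ (SmoothField Ω)}
    (hP : IsPerfectSpace P) (hfin : P.FG) (hΩ : IsPreconnected (Ω : Set Base)) {z : Base}
    (hz : z ∈ Ω) (h0 : ∀ V ∈ P, V.coeff =ᶠ[𝓝 z] 0) : P = ⊥ := by
  obtain ⟨S, hS⟩ := id hfin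
  set A : Set Base := {y | ∀ V ∈ P, V.coeff =ᶠ[𝓝 y] 0} with hA
  -- Testing on finitely many generators turns the locus into a finite intersection of open sets.
  have hAS : A = ⋂ s ∈ S, {y | s.coeff =ᶠ[𝓝 y] 0} := by
    ext y
    simp only [hA, Set.mem_ofPred_eq, Set.mem_iInter]
    refine ⟨fun h s hs => h s (hS ▸ Submodule.subset_span hs), fun h V hV => ?_⟩
    rw [← hS] at hV
    induction hV using Submodule.span_induction with
    | mem V hV => exact h V hV
    | zero => exact EventuallyEq.rfl
    | add V W _ _ hV hW => simpa [SmoothField.coeff_add] using hV.add hW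
    | smul c V _ hV => simpa [SmoothField.coeff_smul] using hV.const_smul c
  have hopen : IsOpen A := by
    rw [hAS]
    exact isOpen_biInter_finset fun s _ => isOpen_setOfPred_eventually_nhds
  have hsub : (Ω : Set Base) ⊆ A := by
    refine hΩ.subset_of_closure_inter_subset hopen ⟨z, hz, h0⟩ ?_
    rintro y ⟨hyA, hyΩ⟩
    refine hP.eventually_eq_zero hfin hyΩ fun V hV => ?_
    -- Derivatives vanish at points of `A` arbitrarily close to `y`, hence at `y` by continuity.
    have hfr : ∃ᶠ x in 𝓝 y, fderiv ℝ V.coeff x = 0 := by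
      refine (mem_closure_iff_frequently.1 hyA).mono fun x hx => ?_
      rw [(hx V hV).fderiv_eq]
      simp
    by_contra hne
    exact hfr ((V.continuousAt_fderiv hyΩ).eventually_ne hne)
  rw [eq_bot_iff]
  intro V hV
  rw [Submodule.mem_bot]
  exact SmoothField.ext_on fun y hy => (hsub hy V hV).eq_of_nhds

/-- If, on an open set, a component of the fields of a perfect space depends on one direction
only, so that brackets act on it as brackets of fields on a line, and if that dependence is
affine, then the component vanishes there. -/
theorem IsPerfectSpace.component_eq_zero {P : Submodule ℝ (SmoothField Ω)}
    (hP : IsPerfectSpace P) {U : Set Base} (hU : IsOpen U) (hUΩ : U ⊆ Ω) (l : Base →L[ℝ] ℝ)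
    (d : Base)
    (h1 : ∀ V ∈ P, ∀ W ∈ P, ∀ z ∈ U,
      fderiv ℝ (fun y => l (V.coeff y)) z (W.coeff z) =
        l (W.coeff z) * fderiv ℝ (fun y => l (V.coeff y)) z d)
    (h2 : ∀ V ∈ P, ∀ z ∈ U, fderiv ℝ (fun y => fderiv ℝ (fun x => l (V.coeff x)) y d) z d = 0) :
    ∀ V ∈ P, ∀ z ∈ U, l (V.coeff z) = 0 := by
  have hsm : ∀ V : SmoothField Ω, ∀ z ∈ U, ContDiffAt ℝ ∞ (fun y => l (V.coeff y)) z :=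
    fun V z hz => l.contDiff.contDiffAt.comp z (V.contDiffAt (hUΩ hz))
  have hdiff : ∀ V : SmoothField Ω, ∀ z ∈ U, DifferentiableAt ℝ (fun y => l (V.coeff y)) z :=
    fun V z hz => (hsm V z hz).differentiableAt (by simp)
  have hdiff2 : ∀ V : SmoothField Ω, ∀ z ∈ U,
      DifferentiableAt ℝ (fun y => fderiv ℝ (fun x => l (V.coeff x)) y d) z := fun V z hz =>
    (((hsm V z hz).fderiv_right (m := 1) (by rw [one_add_one_eq_two]; exact two_le_infty)).differentiableAt (by simp)).clm_apply
      (differentiableAt_const _)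
  have hfd : ∀ V : SmoothField Ω, ∀ z ∈ U, ∀ v,
      fderiv ℝ (fun y => l (V.coeff y)) z v = l (fderiv ℝ V.coeff z v) := by
    intro V z hz v
    have := (l.hasFDerivAt.comp z (V.differentiableAt (hUΩ hz)).hasFDerivAt).fderiv
    exact DFunLike.congr_fun this v
  have hbr : ∀ V ∈ P, ∀ W ∈ P, ∀ z ∈ U, l (⁅V, W⁆.coeff z) =
      l (V.coeff z) * fderiv ℝ (fun y => l (W.coeff y)) z d -
        l (W.coeff z) * fderiv ℝ (fun y => l (V.coeff y)) z d := by
    intro V hV W hW z hz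
    rw [SmoothField.coeff_bracket _ _ (hUΩ hz), lieBracket_eq, map_sub, ← hfd _ _ hz,
      ← hfd _ _ hz, h1 V hV W hW z hz, h1 W hW V hV z hz]
  -- First use of perfectness: (f g' − g f')' = f g'' − g f'' = 0 for affine f and g.
  have hder : ∀ V ∈ P, ∀ z ∈ U, fderiv ℝ (fun y => l (V.coeff y)) z d = 0 := by
    intro V hV z hz
    replace hV := hP hV
    induction hV using Submodule.span_induction with
    | mem Z hZ =>
      obtain ⟨V, hV, W, hW, rfl⟩ := hZ
      have heq : (fun y => l (⁅V, W⁆.coeff y)) =ᶠ[nhds z] fun y =>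
          l (V.coeff y) * fderiv ℝ (fun y => l (W.coeff y)) y d -
            l (W.coeff y) * fderiv ℝ (fun y => l (V.coeff y)) y d := by
        filter_upwards [hU.mem_nhds hz] with y hy using hbr V hV W hW y hy
      have hd := (((hdiff V z hz).hasFDerivAt.mul (hdiff2 W z hz).hasFDerivAt).sub
        ((hdiff W z hz).hasFDerivAt.mul (hdiff2 V z hz).hasFDerivAt)).fderiv
      rw [heq.fderiv_eq]
      refine (DFunLike.congr_fun hd d).trans ?_
      simp only [sub_apply, add_apply,
        smul_apply, smul_eq_mul, h2 V hV z hz, h2 W hW z hz]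
      ring
    | zero => simp [SmoothField.coeff_zero]
    | add V W _ _ hV hW =>
      rw [hfd _ _ hz] at hV hW ⊢
      rw [SmoothField.coeff_add, fderiv_add (V.differentiableAt (hUΩ hz))
        (W.differentiableAt (hUΩ hz)), add_apply, map_add, hV, hW, add_zero]
    | smul c V _ hV =>
      rw [hfd _ _ hz] at hV ⊢
      rw [SmoothField.coeff_smul, fderiv_const_smul (V.differentiableAt (hUΩ hz)),
        smul_apply, map_smul, hV, smul_zero]
  intro V hV z hz
  -- Second use of perfectness: with f' = g' = 0, the bracket f g' − g f' is itself zero.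
  replace hV := hP hV
  induction hV using Submodule.span_induction with
  | mem Z hZ =>
    obtain ⟨V, hV, W, hW, rfl⟩ := hZ
    rw [hbr V hV W hW z hz, hder V hV z hz, hder W hW z hz]
    ring
  | zero => simp [SmoothField.coeff_zero]
  | add V W _ _ hV hW => rw [SmoothField.coeff_add, Pi.add_apply, map_add, hV, hW, add_zero]
  | smul c V _ hV => rw [SmoothField.coeff_smul, Pi.smul_apply, map_smul, hV, smul_zero]

end Perfect

/-! ### Determining equations -/

section Determining

/-- The basis vector `∂_t` of the space of points `(t, x, u)`. -/
def dirT : Base := (1, 0, 0)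

/-- The basis vector `∂_x`. -/
def dirX : Base := (0, 1, 0)

/-- The basis vector `∂_u`. -/
def dirU : Base := (0, 0, 1)

/-- Product rule for pairing `fderiv ℝ f` with the moving vector (1, 0, u_t). The existential hides
the composite linear map; later only its values are needed. -/
theorem hasFDerivAt_totalT {f : Base → ℝ} {j : Jet1} (hf : ContDiffAt ℝ 2 f j.base) :
    ∃ L : Jet1 →L[ℝ] ℝ, HasFDerivAt (totalT f) L j ∧ ∀ v a b, L (v, a, b) =
      fderiv ℝ (fderiv ℝ f) j.base v (1, 0, j.ut) + fderiv ℝ f j.base (0, 0, a) := by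
  have h2 : HasFDerivAt (fderiv ℝ f) (fderiv ℝ (fderiv ℝ f) j.1) j.1 :=
    ((hf.fderiv_right (m := 1) (by norm_num)).differentiableAt (by simp)).hasFDerivAt
  have h3 : HasFDerivAt (fun j : Jet1 => fderiv ℝ f j.1) _ j :=
    h2.comp j (hasFDerivAt_fst (𝕜 := ℝ) (p := j))
  have h4 : HasFDerivAt (fun j : Jet1 => ((1, 0, j.2.1) : Base)) _ j :=
    (hasFDerivAt_const (1 : ℝ) j).prodMk ((hasFDerivAt_const (0 : ℝ) j).prodMk
      (hasFDerivAt_fst.comp j (hasFDerivAt_snd (𝕜 := ℝ) (p := j))))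
  refine ⟨_, h3.clm_apply h4, fun v a b => ?_⟩
  simp [Jet1.base, Jet1.ut, add_comm]

theorem hasFDerivAt_totalX {f : Base → ℝ} {j : Jet1} (hf : ContDiffAt ℝ 2 f j.base) :
    ∃ L : Jet1 →L[ℝ] ℝ, HasFDerivAt (totalX f) L j ∧ ∀ v a b, L (v, a, b) =
      fderiv ℝ (fderiv ℝ f) j.base v (0, 1, j.ux) + fderiv ℝ f j.base (0, 0, b) := by
  have h2 : HasFDerivAt (fderiv ℝ f) (fderiv ℝ (fderiv ℝ f) j.1) j.1 :=
    ((hf.fderiv_right (m := 1) (by norm_num)).differentiableAt (by simp)).hasFDerivAt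
  have h3 : HasFDerivAt (fun j : Jet1 => fderiv ℝ f j.1) _ j :=
    h2.comp j (hasFDerivAt_fst (𝕜 := ℝ) (p := j))
  have h4 : HasFDerivAt (fun j : Jet1 => ((0, 1, j.2.2) : Base)) _ j :=
    (hasFDerivAt_const (0 : ℝ) j).prodMk ((hasFDerivAt_const (1 : ℝ) j).prodMk
      (hasFDerivAt_snd.comp j (hasFDerivAt_snd (𝕜 := ℝ) (p := j))))
  refine ⟨_, h3.clm_apply h4, fun v a b => ?_⟩
  simp [Jet1.base, Jet1.ux, add_comm]

theorem hasFDerivAt_ut (j : Jet1) : HasFDerivAt Jet1.ut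
    ((ContinuousLinearMap.fst ℝ ℝ ℝ).comp (ContinuousLinearMap.snd ℝ Base (ℝ × ℝ))) j :=
  hasFDerivAt_fst.comp j (hasFDerivAt_snd (𝕜 := ℝ) (p := j))

theorem hasFDerivAt_ux (j : Jet1) : HasFDerivAt Jet1.ux
    ((ContinuousLinearMap.snd ℝ ℝ ℝ).comp (ContinuousLinearMap.snd ℝ Base (ℝ × ℝ))) j :=
  hasFDerivAt_snd.comp j (hasFDerivAt_snd (𝕜 := ℝ) (p := j))

variable {Ω : TopologicalSpace.Opens Base}

namespace SmoothField

theorem contDiffAt_tau (Q : SmoothField Ω) {z : Base} (hz : z ∈ Ω) : ContDiffAt ℝ ∞ Q.tau z :=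
  contDiffAt_fst.comp z (Q.contDiffAt hz)

theorem contDiffAt_xi (Q : SmoothField Ω) {z : Base} (hz : z ∈ Ω) : ContDiffAt ℝ ∞ Q.xi z :=
  (contDiffAt_fst.comp _ contDiffAt_snd).comp z (Q.contDiffAt hz)

theorem contDiffAt_eta (Q : SmoothField Ω) {z : Base} (hz : z ∈ Ω) : ContDiffAt ℝ ∞ Q.eta z :=
  (contDiffAt_snd.comp _ contDiffAt_snd).comp z (Q.contDiffAt hz)

end SmoothField

theorem totalT₁_phiT (Q : SmoothField Ω) {j : Jet2} (hj : j.jet1.base ∈ Ω) :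
    totalT₁ (phiT Q) j =
      (fderiv ℝ (fderiv ℝ Q.eta) j.jet1.base (1, 0, j.jet1.ut) (1, 0, j.jet1.ut)
        + fderiv ℝ Q.eta j.jet1.base (0, 0, j.utt))
      - (j.jet1.ut * (fderiv ℝ (fderiv ℝ Q.tau) j.jet1.base (1, 0, j.jet1.ut) (1, 0, j.jet1.ut)
        + fderiv ℝ Q.tau j.jet1.base (0, 0, j.utt)) + j.utt * totalT Q.tau j.jet1)
      - (j.jet1.ux * (fderiv ℝ (fderiv ℝ Q.xi) j.jet1.base (1, 0, j.jet1.ut) (1, 0, j.jet1.ut)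
        + fderiv ℝ Q.xi j.jet1.base (0, 0, j.utt)) + j.utx * totalT Q.xi j.jet1) := by
  obtain ⟨L1, h1, e1⟩ := hasFDerivAt_totalT ((Q.contDiffAt_eta hj).of_le two_le_infty)
  obtain ⟨L2, h2, e2⟩ := hasFDerivAt_totalT ((Q.contDiffAt_tau hj).of_le two_le_infty)
  obtain ⟨L3, h3, e3⟩ := hasFDerivAt_totalT ((Q.contDiffAt_xi hj).of_le two_le_infty)
  have h := ((h1.sub ((hasFDerivAt_ut j.jet1).mul h2)).sub
    ((hasFDerivAt_ux j.jet1).mul h3)).fderiv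
  refine (DFunLike.congr_fun h _).trans ?_
  simp [e1, e2, e3, mul_comm]

theorem totalX₁_phiX (Q : SmoothField Ω) {j : Jet2} (hj : j.jet1.base ∈ Ω) :
    totalX₁ (phiX Q) j =
      (fderiv ℝ (fderiv ℝ Q.eta) j.jet1.base (0, 1, j.jet1.ux) (0, 1, j.jet1.ux)
        + fderiv ℝ Q.eta j.jet1.base (0, 0, j.uxx))
      - (j.jet1.ut * (fderiv ℝ (fderiv ℝ Q.tau) j.jet1.base (0, 1, j.jet1.ux) (0, 1, j.jet1.ux)
        + fderiv ℝ Q.tau j.jet1.base (0, 0, j.uxx)) + j.utx * totalX Q.tau j.jet1)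
      - (j.jet1.ux * (fderiv ℝ (fderiv ℝ Q.xi) j.jet1.base (0, 1, j.jet1.ux) (0, 1, j.jet1.ux)
        + fderiv ℝ Q.xi j.jet1.base (0, 0, j.uxx)) + j.uxx * totalX Q.xi j.jet1) := by
  obtain ⟨L1, h1, e1⟩ := hasFDerivAt_totalX ((Q.contDiffAt_eta hj).of_le two_le_infty)
  obtain ⟨L2, h2, e2⟩ := hasFDerivAt_totalX ((Q.contDiffAt_tau hj).of_le two_le_infty)
  obtain ⟨L3, h3, e3⟩ := hasFDerivAt_totalX ((Q.contDiffAt_xi hj).of_le two_le_infty)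
  have h := ((h1.sub ((hasFDerivAt_ut j.jet1).mul h2)).sub
    ((hasFDerivAt_ux j.jet1).mul h3)).fderiv
  refine (DFunLike.congr_fun h _).trans ?_
  simp [e1, e2, e3, mul_comm]

theorem clm_apply_eq {E : Type*} [NormedAddCommGroup E] [NormedSpace ℝ E] (L : Base →L[ℝ] E)
    (a b c : ℝ) : L (a, b, c) = a • L dirT + b • L dirX + c • L dirU := by
  rw [← map_smul, ← map_smul, ← map_smul, ← map_add, ← map_add]
  simp [dirT, dirX, dirU]

theorem fderiv_fderiv_symm {f : Base → ℝ} {z : Base} (hf : ContDiffAt ℝ ∞ f z) (v w : Base) :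
    fderiv ℝ (fderiv ℝ f) z v w = fderiv ℝ (fderiv ℝ f) z w v :=
  (hf.isSymmSndFDerivAt (by simpa using two_le_infty)) v w

end Determining

/-! ### Solvability -/

section Solvable

/-- A finite-dimensional Lie algebra without nonzero perfect ideals is solvable. -/
theorem isSolvable_of_perfect_eq_bot {L : Type*} [LieRing L] [LieAlgebra ℝ L]
    [FiniteDimensional ℝ L] (h : ∀ I : LieIdeal ℝ L, ⁅I, I⁆ = I → I = ⊥) :
    LieAlgebra.IsSolvable L := by
  have hanti : Antitone (LieAlgebra.derivedSeries ℝ L) := fun m n hmn =>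
    LieAlgebra.derivedSeriesOfIdeal_antitone ⊤ hmn
  -- The order dual turns the decreasing derived series into a monotone chain, to which the chain
  -- condition applies.
  have : WellFoundedGT (LieIdeal ℝ L)ᵒᵈ :=
    haveI := LieSubmodule.wellFoundedLT_of_isArtinian ℝ L L
    inferInstance
  obtain ⟨k, hk⟩ := WellFoundedGT.monotone_chain_condition
    (α := (LieIdeal ℝ L)ᵒᵈ) ⟨fun n => OrderDual.toDual (LieAlgebra.derivedSeries ℝ L n), hanti⟩
  refine LieAlgebra.IsSolvable.mk (R := ℝ) (k := k) (h _ ?_)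
  have h' : LieAlgebra.derivedSeries ℝ L k = LieAlgebra.derivedSeries ℝ L (k + 1) :=
    congrArg OrderDual.ofDual (hk (k + 1) k.le_succ)
  rw [LieAlgebra.derivedSeries_def, LieAlgebra.derivedSeries_def,
    LieAlgebra.derivedSeriesOfIdeal_succ] at h'
  exact h'.symm

/-- The radical of a solvable algebra is everything, which leaves only zero as a complement. -/
theorem IsLeviFactor.eq_bot {s : Type*} [LieRing s] [LieAlgebra ℝ s] [LieAlgebra.IsSolvable s]
    {l : LieSubalgebra ℝ s} (hl : IsLeviFactor l) : l = ⊥ := by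
  have h := hl.isCompl
  rw [LieAlgebra.radical_eq_top_of_isSolvable, LieSubmodule.top_toSubmodule] at h
  exact LieSubalgebra.toSubmodule_injective (eq_bot_of_isCompl_top h)

variable {Ω : TopologicalSpace.Opens Base}

/-- A finite-dimensional Lie algebra of fields is solvable if its perfect subspaces are trivial. -/
theorem isSolvable_of_perfectSpace_eq_bot (g : LieSubalgebra ℝ (SmoothField Ω))
    [FiniteDimensional ℝ g]
    (h : ∀ P : Submodule ℝ (SmoothField Ω), P ≤ g.toSubmodule → P.FG → IsPerfectSpace P → P = ⊥) :
    LieAlgebra.IsSolvable g := by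
  refine isSolvable_of_perfect_eq_bot fun I hI => ?_
  have hbot := h (I.toSubmodule.map g.toSubmodule.subtype) (Submodule.map_subtype_le _ _)
    ((IsNoetherian.noetherian I.toSubmodule).map _) ?_
  · exact (LieSubmodule.toSubmodule_eq_bot I).1
      (Submodule.map_injective_of_injective g.toSubmodule.injective_subtype
        (hbot.trans (Submodule.map_bot _).symm))
  · have hspan : I.toSubmodule ≤ Submodule.span ℝ {m | ∃ x ∈ I, ∃ n ∈ I, ⁅x, n⁆ = m} := by
      rw [← LieSubmodule.lieIdeal_oper_eq_linear_span', hI]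
    refine (Submodule.map_mono hspan).trans ?_
    rw [Submodule.map_span]
    refine Submodule.span_mono ?_
    rintro _ ⟨_, ⟨x, hx, y, hy, rfl⟩, rfl⟩
    exact ⟨x, ⟨x, hx, rfl⟩, y, ⟨y, hy, rfl⟩, rfl⟩

end Solvable

/-! ### Symmetries of the wave equation -/

section Symmetry

theorem clm_apply_T {E : Type*} [NormedAddCommGroup E] [NormedSpace ℝ E] (L : Base →L[ℝ] E)
    (a : ℝ) : L (1, 0, a) = L dirT + a • L dirU := by simp [clm_apply_eq L 1 0 a]

theorem clm_apply_X {E : Type*} [NormedAddCommGroup E] [NormedSpace ℝ E] (L : Base →L[ℝ] E)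
    (a : ℝ) : L (0, 1, a) = L dirX + a • L dirU := by simp [clm_apply_eq L 0 1 a]

theorem clm_apply_U {E : Type*} [NormedAddCommGroup E] [NormedSpace ℝ E] (L : Base →L[ℝ] E)
    (a : ℝ) : L (0, 0, a) = a • L dirU := by simp [clm_apply_eq L 0 0 a]

theorem fderiv_fderiv_apply {f : Base → ℝ} {z : Base} (hf : ContDiffAt ℝ ∞ f z) (d v : Base) :
    fderiv ℝ (fun y => fderiv ℝ f y d) z v = fderiv ℝ (fderiv ℝ f) z v d := by
  have h2 : HasFDerivAt (fderiv ℝ f) (fderiv ℝ (fderiv ℝ f) z) z :=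
    ((hf.fderiv_right (m := 1)
      (by rw [one_add_one_eq_two]; exact two_le_infty)).differentiableAt (by simp)).hasFDerivAt
  rw [(h2.clm_apply (hasFDerivAt_const d z)).fderiv]
  simp

/-- Serves to differentiate the first-order determining equations, which hold on an open set. -/
theorem fderiv_fderiv_congr {f g : Base → ℝ} {U : Set Base} (hU : IsOpen U) {z : Base}
    (hz : z ∈ U) (hf : ContDiffAt ℝ ∞ f z) (hg : ContDiffAt ℝ ∞ g z) {d e : Base}
    (h : ∀ y ∈ U, fderiv ℝ f y d = fderiv ℝ g y e) (v : Base) :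
    fderiv ℝ (fderiv ℝ f) z v d = fderiv ℝ (fderiv ℝ g) z v e := by
  rw [← fderiv_fderiv_apply hf, ← fderiv_fderiv_apply hg]
  have : (fun y => fderiv ℝ f y d) =ᶠ[nhds z] fun y => fderiv ℝ g y e := by
    filter_upwards [hU.mem_nhds hz] with y hy using h y hy
  rw [this.fderiv_eq]

theorem fderiv_fderiv_eq_zero {f : Base → ℝ} {U : Set Base} (hU : IsOpen U) {z : Base}
    (hz : z ∈ U) (hf : ContDiffAt ℝ ∞ f z) {d : Base} (h : ∀ y ∈ U, fderiv ℝ f y d = 0)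
    (v : Base) : fderiv ℝ (fderiv ℝ f) z v d = 0 := by
  simpa using fderiv_fderiv_congr hU hz hf hf (e := 0) (by simpa using h) v

variable {W : TopologicalSpace.Opens (Base × ℝ)} {F : Base × ℝ → ℝ}
  {Q : SmoothField (baseDomain W)}

theorem mem_baseDomain {z : Base} {p : ℝ} (h : (z, p) ∈ W) : z ∈ baseDomain W := ⟨_, h, rfl⟩

/-- The invariance criterion at a point, as a polynomial identity in `u_t`, `u_tx`, `u_xx`. -/
theorem IsSymmetry.polynomial_eq_zero (hQ : IsSymmetry W F Q) {z : Base} {p : ℝ} (h : (z, p) ∈ W)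
    (a r s : ℝ) :
    (fderiv ℝ (fderiv ℝ Q.eta) z dirT dirT + a * fderiv ℝ (fderiv ℝ Q.eta) z dirT dirU
        + a * (fderiv ℝ (fderiv ℝ Q.eta) z dirU dirT + a * fderiv ℝ (fderiv ℝ Q.eta) z dirU dirU)
        + (s + F (z, p)) * fderiv ℝ Q.eta z dirU)
      - a * (fderiv ℝ (fderiv ℝ Q.tau) z dirT dirT + a * fderiv ℝ (fderiv ℝ Q.tau) z dirT dirU
        + a * (fderiv ℝ (fderiv ℝ Q.tau) z dirU dirT + a * fderiv ℝ (fderiv ℝ Q.tau) z dirU dirU)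
        + (s + F (z, p)) * fderiv ℝ Q.tau z dirU)
      - p * (fderiv ℝ (fderiv ℝ Q.xi) z dirT dirT + a * fderiv ℝ (fderiv ℝ Q.xi) z dirT dirU
        + a * (fderiv ℝ (fderiv ℝ Q.xi) z dirU dirT + a * fderiv ℝ (fderiv ℝ Q.xi) z dirU dirU)
        + (s + F (z, p)) * fderiv ℝ Q.xi z dirU)
      - 2 * (s + F (z, p)) * (fderiv ℝ Q.tau z dirT + a * fderiv ℝ Q.tau z dirU)
      - 2 * r * (fderiv ℝ Q.xi z dirT + a * fderiv ℝ Q.xi z dirU)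
      - ((fderiv ℝ (fderiv ℝ Q.eta) z dirX dirX + p * fderiv ℝ (fderiv ℝ Q.eta) z dirX dirU
        + p * (fderiv ℝ (fderiv ℝ Q.eta) z dirU dirX + p * fderiv ℝ (fderiv ℝ Q.eta) z dirU dirU)
        + s * fderiv ℝ Q.eta z dirU)
      - a * (fderiv ℝ (fderiv ℝ Q.tau) z dirX dirX + p * fderiv ℝ (fderiv ℝ Q.tau) z dirX dirU
        + p * (fderiv ℝ (fderiv ℝ Q.tau) z dirU dirX + p * fderiv ℝ (fderiv ℝ Q.tau) z dirU dirU)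
        + s * fderiv ℝ Q.tau z dirU)
      - p * (fderiv ℝ (fderiv ℝ Q.xi) z dirX dirX + p * fderiv ℝ (fderiv ℝ Q.xi) z dirX dirU
        + p * (fderiv ℝ (fderiv ℝ Q.xi) z dirU dirX + p * fderiv ℝ (fderiv ℝ Q.xi) z dirU dirU)
        + s * fderiv ℝ Q.xi z dirU)
      - 2 * r * (fderiv ℝ Q.tau z dirX + p * fderiv ℝ Q.tau z dirU)
      - 2 * s * (fderiv ℝ Q.xi z dirX + p * fderiv ℝ Q.xi z dirU))
      - (fderiv ℝ F (z, p) (Q.coeff z, 0) +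
        (fderiv ℝ Q.eta z dirX + p * fderiv ℝ Q.eta z dirU
          - a * (fderiv ℝ Q.tau z dirX + p * fderiv ℝ Q.tau z dirU)
          - p * (fderiv ℝ Q.xi z dirX + p * fderiv ℝ Q.xi z dirU)) * fderiv ℝ F (z, p) (0, 1))
      = 0 := by
  -- The free jet coordinates are u_t = a, u_tx = r, u_xx = s; the equation fixes u_tt.
  have H := hQ ((z, a, p), s + F (z, p), r, s) h rfl
  have hz : (Jet2.jet1 ((z, a, p), s + F (z, p), r, s)).base ∈ baseDomain W := mem_baseDomain h
  have hF : ∀ φ : ℝ, fderiv ℝ F (z, p) (Q.coeff z, φ) =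
      fderiv ℝ F (z, p) (Q.coeff z, 0) + φ * fderiv ℝ F (z, p) (0, 1) := by
    intro φ
    rw [← smul_eq_mul, ← map_smul, ← map_add]
    simp
  rw [phiTT, phiXX, totalT₁_phiT Q hz, totalX₁_phiX Q hz] at H
  simp only [Jet2.jet1, Jet1.base, Jet1.ut, Jet1.ux, Jet2.utt, Jet2.utx, Jet2.uxx, phiX,
    totalT, totalX] at H
  rw [hF] at H
  simp only [clm_apply_T, clm_apply_X, clm_apply_U, add_apply, smul_apply, smul_eq_mul] at H
  linear_combination H

/-- First determining equations. -/
theorem IsSymmetry.first_order (hQ : IsSymmetry W F Q) {z : Base} {p q : ℝ} (hpq : p ≠ q)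
    (hp : (z, p) ∈ W) (hq : (z, q) ∈ W) :
    fderiv ℝ Q.tau z dirU = 0 ∧ fderiv ℝ Q.xi z dirU = 0 ∧
      fderiv ℝ Q.xi z dirT = fderiv ℝ Q.tau z dirX ∧
      fderiv ℝ Q.tau z dirT = fderiv ℝ Q.xi z dirX := by
  have H := hQ.polynomial_eq_zero hp
  have H' := hQ.polynomial_eq_zero hq
  -- The coefficient of u_tx is 2(τ_x + p τ_u − ξ_t − a ξ_u): comparing two slopes isolates τ_u, two
  -- values of `a` isolate ξ_u. The coefficient of u_xx at a = 0 then gives τ_t = ξ_x.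
  have h1 : fderiv ℝ Q.tau z dirU = 0 := by
    have : (p - q) * fderiv ℝ Q.tau z dirU = 0 := by
      linear_combination (H 0 1 0 - H 0 0 0 - (H' 0 1 0 - H' 0 0 0)) / 2
    exact (mul_eq_zero.1 this).resolve_left (sub_ne_zero.2 hpq)
  have h2 : fderiv ℝ Q.xi z dirU = 0 := by
    linear_combination ((H 0 1 0 - H 0 0 0) - (H 1 1 0 - H 1 0 0)) / 2
  refine ⟨h1, h2, ?_, ?_⟩
  · linear_combination -(H 0 1 0 - H 0 0 0) / 2 + p * h1
  · linear_combination -(H 0 0 1 - H 0 0 0) / 2 + p * h2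

/-- Where `F` is not affine in `u_x`, a symmetry has `τ_x = 0` and `η_uu = 0`. -/
theorem IsSymmetry.second_order (hQ : IsSymmetry W F Q) {U : Set Base} (hU : IsOpen U) {p q : ℝ}
    (hp : ∀ z ∈ U, (z, p) ∈ W) (hq : ∀ z ∈ U, (z, q) ∈ W)
    (hpq : ∀ z ∈ U, fderiv ℝ F (z, p) (0, 1) ≠ fderiv ℝ F (z, q) (0, 1)) {z : Base} (hz : z ∈ U) :
    fderiv ℝ Q.tau z dirX = 0 ∧ fderiv ℝ (fderiv ℝ Q.eta) z dirU dirU = 0 := by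
  have hne : p ≠ q := fun h => hpq z hz (by rw [h])
  have h1 := fun y (hy : y ∈ U) => hQ.first_order hne (hp y hy) (hq y hy)
  have hzΩ := mem_baseDomain (hp z hz)
  have ht := fun v => fderiv_fderiv_eq_zero hU hz (Q.contDiffAt_tau hzΩ)
    (fun y hy => (h1 y hy).1) v
  have hx := fun v => fderiv_fderiv_eq_zero hU hz (Q.contDiffAt_xi hzΩ)
    (fun y hy => (h1 y hy).2.1) v
  have ht' := fun v => (fderiv_fderiv_symm (Q.contDiffAt_tau hzΩ) dirU v).trans (ht v)
  have hx' := fun v => (fderiv_fderiv_symm (Q.contDiffAt_xi hzΩ) dirU v).trans (hx v)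
  have H := hQ.polynomial_eq_zero (hp z hz)
  have H' := hQ.polynomial_eq_zero (hq z hz)
  simp only [ht, hx, ht', hx', (h1 z hz).1, (h1 z hz).2.1] at H H'
  constructor
  -- The part odd in u_t has coefficient 2η_tu − τ_tt + τ_xx + τ_x F_{u_x}; only its last term
  -- depends on the slope.
  · have : (fderiv ℝ F (z, p) (0, 1) - fderiv ℝ F (z, q) (0, 1)) * fderiv ℝ Q.tau z dirX = 0 := by
      linear_combination (H 1 0 0 - H (-1) 0 0 - (H' 1 0 0 - H' (-1) 0 0)) / 2
    exact (mul_eq_zero.1 this).resolve_left (sub_ne_zero.2 (hpq z hz))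
  -- The second difference in u_t extracts the coefficient of u_t², which is η_uu.
  · linear_combination (H 1 0 0 + H (-1) 0 0 - 2 * H 0 0 0) / 2

/-- A perfect space of symmetries vanishes where `F` is not affine in `u_x`. -/
theorem IsPerfectSpace.coeff_eq_zero {P : Submodule ℝ (SmoothField (baseDomain W))}
    (hP : IsPerfectSpace P) (hsymm : ∀ Q ∈ P, IsSymmetry W F Q) {U : Set Base} (hU : IsOpen U)
    {p q : ℝ} (hp : ∀ z ∈ U, (z, p) ∈ W) (hq : ∀ z ∈ U, (z, q) ∈ W)
    (hpq : ∀ z ∈ U, fderiv ℝ F (z, p) (0, 1) ≠ fderiv ℝ F (z, q) (0, 1)) :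
    ∀ Q ∈ P, ∀ z ∈ U, Q.coeff z = 0 := by
  have hUΩ : U ⊆ baseDomain W := fun z hz => mem_baseDomain (hp z hz)
  have h1 := fun Q (hQ : Q ∈ P) z (hz : z ∈ U) => (hsymm Q hQ).first_order
    (fun h => hpq z hz (by rw [h])) (hp z hz) (hq z hz)
  have h2 := fun Q (hQ : Q ∈ P) z (hz : z ∈ U) => (hsymm Q hQ).second_order hU hp hq hpq hz
  have h3 : ∀ Q ∈ P, ∀ z ∈ U, fderiv ℝ Q.xi z dirT = 0 := fun Q hQ z hz =>
    (h1 Q hQ z hz).2.2.1.trans (h2 Q hQ z hz).1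
  have happ : ∀ (L : Base →L[ℝ] ℝ) (Q : SmoothField (baseDomain W)) (z : Base), L (Q.coeff z) =
      Q.tau z * L dirT + Q.xi z * L dirX + Q.eta z * L dirU := fun L Q z =>
    clm_apply_eq L (Q.coeff z).1 (Q.coeff z).2.1 (Q.coeff z).2.2
  have htau : ∀ Q ∈ P, ∀ z ∈ U, Q.tau z = 0 := by
    refine hP.component_eq_zero hU hUΩ (ContinuousLinearMap.fst ℝ ℝ (ℝ × ℝ)) dirT ?_ ?_
    · intro V hV Q _ z hz
      change fderiv ℝ V.tau z (Q.coeff z) = Q.tau z * fderiv ℝ V.tau z dirT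
      rw [happ, (h1 V hV z hz).1, (h2 V hV z hz).1]
      ring
    · intro V hV z hz
      have ht := V.contDiffAt_tau (hUΩ hz)
      have hx := V.contDiffAt_xi (hUΩ hz)
      change fderiv ℝ (fun y => fderiv ℝ V.tau y dirT) z dirT = 0
      -- τ_tt = (ξ_x)_t = (ξ_t)_x = 0; symmetrically below, ξ_xx = (τ_t)_x = (τ_x)_t = 0.
      rw [fderiv_fderiv_apply ht,
        fderiv_fderiv_congr hU hz ht hx (fun y hy => (h1 V hV y hy).2.2.2), fderiv_fderiv_symm hx,
        fderiv_fderiv_eq_zero hU hz hx (h3 V hV)]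
  have hxi : ∀ Q ∈ P, ∀ z ∈ U, Q.xi z = 0 := by
    refine hP.component_eq_zero hU hUΩ ((ContinuousLinearMap.fst ℝ ℝ ℝ).comp
      (ContinuousLinearMap.snd ℝ ℝ (ℝ × ℝ))) dirX ?_ ?_
    · intro V hV Q _ z hz
      change fderiv ℝ V.xi z (Q.coeff z) = Q.xi z * fderiv ℝ V.xi z dirX
      rw [happ, (h1 V hV z hz).2.1, h3 V hV z hz]
      ring
    · intro V hV z hz
      have ht := V.contDiffAt_tau (hUΩ hz)
      have hx := V.contDiffAt_xi (hUΩ hz)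
      change fderiv ℝ (fun y => fderiv ℝ V.xi y dirX) z dirX = 0
      rw [fderiv_fderiv_apply hx,
        ← fderiv_fderiv_congr hU hz ht hx (fun y hy => (h1 V hV y hy).2.2.2),
        fderiv_fderiv_symm ht, fderiv_fderiv_eq_zero hU hz ht (fun y hy => (h2 V hV y hy).1)]
  have heta : ∀ Q ∈ P, ∀ z ∈ U, Q.eta z = 0 := by
    refine hP.component_eq_zero hU hUΩ ((ContinuousLinearMap.snd ℝ ℝ ℝ).comp
      (ContinuousLinearMap.snd ℝ ℝ (ℝ × ℝ))) dirU ?_ ?_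
    · intro V _ Q hQ z hz
      change fderiv ℝ V.eta z (Q.coeff z) = Q.eta z * fderiv ℝ V.eta z dirU
      -- Only η ∂_u is left of each field, so η may depend on t and x arbitrarily.
      rw [happ, htau Q hQ z hz, hxi Q hQ z hz]
      ring
    · intro V hV z hz
      change fderiv ℝ (fun y => fderiv ℝ V.eta y dirU) z dirU = 0
      rw [fderiv_fderiv_apply (V.contDiffAt_eta (hUΩ hz)), (h2 V hV z hz).2]
  exact fun Q hQ z hz => Prod.ext (htau Q hQ z hz) (Prod.ext (hxi Q hQ z hz) (heta Q hQ z hz))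

open Filter Topology in
/-- If `F_{u_x u_x}` is not identically zero, then `F_{u_x}` takes different values at two fixed
values of `u_x`, for all `(t, x, u)` in an open set. -/
theorem exists_open_fderiv_ne (hF : ContDiffOn ℝ ∞ F W) {w : Base × ℝ} (hw : w ∈ W)
    (h : secondPartial F w ≠ 0) :
    ∃ (U : Set Base) (p q : ℝ), IsOpen U ∧ w.1 ∈ U ∧ (∀ z ∈ U, (z, p) ∈ W) ∧
      (∀ z ∈ U, (z, q) ∈ W) ∧
      ∀ z ∈ U, fderiv ℝ F (z, p) (0, 1) ≠ fderiv ℝ F (z, q) (0, 1) := by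
  obtain ⟨z, q⟩ := w
  have hsm : ∀ v ∈ W, ContDiffAt ℝ ∞ F v := fun v hv => hF.contDiffAt (W.isOpen.mem_nhds hv)
  have hpart : ∀ p, (z, p) ∈ W →
      deriv (fun p => F (z, p)) p = fderiv ℝ F (z, p) (0, 1) := fun p hp =>
    (((hsm _ hp).differentiableAt (by simp)).hasFDerivAt.comp_hasDerivAt p
      ((hasDerivAt_const p z).prodMk (hasDerivAt_id p))).deriv
  have hcont : ∀ p, (z, p) ∈ W → ContinuousAt (fun y => fderiv ℝ F (y, p) (0, 1)) z := by
    intro p hp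
    have h1 : ContinuousAt (fderiv ℝ F) (z, p) :=
      ((hsm _ hp).fderiv_right (m := 0) (by simp)).continuousAt
    have h2 : ContinuousAt (fun y : Base => (y, p)) z := by fun_prop
    exact (ContinuousAt.comp (f := fun y : Base => (y, p)) h1 h2).clm_apply continuousAt_const
  have hmem : ∀ p, (z, p) ∈ W → ∀ᶠ y in 𝓝 z, (y, p) ∈ W := fun p hp =>
    (show ContinuousAt (fun y : Base => (y, p)) z by fun_prop).preimage_mem_nhds
      (W.isOpen.mem_nhds hp)
  have hWp : ∀ᶠ p in 𝓝 q, (z, p) ∈ W :=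
    (show ContinuousAt (fun p : ℝ => (z, p)) q by fun_prop).preimage_mem_nhds
      (W.isOpen.mem_nhds hw)
  -- `deriv` defaults to 0 where there is no derivative, so a nonzero value certifies
  -- differentiability. It also makes F_{u_x} differ from its value at `q` at nearby slopes, one of
  -- which serves as `p`.
  have hd : HasDerivAt (deriv fun p => F (z, p)) (secondPartial F (z, q)) q :=
    (differentiableAt_of_deriv_ne_zero h).hasDerivAt
  obtain ⟨p, hp, hpW⟩ := ((hd.eventually_ne (c := deriv (fun p => F (z, p)) q) h).and
    (hWp.filter_mono nhdsWithin_le_nhds)).exists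
  rw [hpart p hpW, hpart q hw] at hp
  have hev := (hmem p hpW).and ((hmem q hw).and
    (((hcont p hpW).ne_iff_eventually_ne (hcont q hw)).1 hp))
  obtain ⟨U, hU, hUo, hzU⟩ := mem_nhds_iff.1 hev
  exact ⟨U, p, q, hUo, hzU, fun y hy => (hU hy).1, fun y hy => (hU hy).2.1,
    fun y hy => (hU hy).2.2⟩

/-- A finite-dimensional Lie algebra of symmetries is solvable if `F_{u_x u_x}` is not
identically zero. -/
theorem Admits.isSolvable (hW : IsConnected (baseDomain W : Set Base)) (hF : ContDiffOn ℝ ∞ F W)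
    (hFpp : ∃ w ∈ W, secondPartial F w ≠ 0) {g : LieSubalgebra ℝ (SmoothField (baseDomain W))}
    (hg : Admits W F g) [FiniteDimensional ℝ g] : LieAlgebra.IsSolvable g := by
  obtain ⟨w, hw, hne⟩ := hFpp
  obtain ⟨U, p, q, hU, hwU, hp, hq, hpq⟩ := exists_open_fderiv_ne hF hw hne
  refine isSolvable_of_perfectSpace_eq_bot g fun P hPg hfin hP => ?_
  refine hP.eq_bot hfin hW.isPreconnected (mem_baseDomain hw) fun V hV => ?_
  filter_upwards [hU.mem_nhds hwU] with z hz
  exact hP.coeff_eq_zero (fun Q hQ => hg Q (hPg hQ)) hU hp hq hpq V hV z hz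

end Symmetry

end WaveSymmetry

end

theorem mainTheorem5 (W : TopologicalSpace.Opens (WaveSymmetry.Base × ℝ))
    (hW : IsConnected (WaveSymmetry.baseDomain W : Set WaveSymmetry.Base))
    (F : WaveSymmetry.Base × ℝ → ℝ) (hF : ContDiffOn ℝ ∞ F W)
    (hFpp : ∃ w ∈ W, WaveSymmetry.secondPartial F w ≠ 0)
    (g : LieSubalgebra ℝ (WaveSymmetry.SmoothField (WaveSymmetry.baseDomain W)))
    (hg : WaveSymmetry.Admits W F g) :
    (¬ ∃ s : LieSubalgebra ℝ (WaveSymmetry.SmoothField (WaveSymmetry.baseDomain W)),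
        s ≤ g ∧ FiniteDimensional ℝ s ∧
          ∃ l : LieSubalgebra ℝ s, WaveSymmetry.IsLeviFactor l ∧ l ≠ ⊥) ∧
      (FiniteDimensional ℝ g → LieAlgebra.IsSolvable g) := by
  refine ⟨?_, fun _ => hg.isSolvable hW hF hFpp⟩
  rintro ⟨s, hsg, hfin, l, hl, hne⟩
  have hs : WaveSymmetry.Admits W F s := fun Q hQ => hg Q (hsg hQ)
  have := hs.isSolvable hW hF hFpp
  exact hne hl.eq_bot
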